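/- Let $\mathbb S\subset\mathbb R$ be a finite set and let $\boldsymbol G=(G(x,y))_{x,y\in\mathbb S}$ be a transition rate matrix, i.e. $G(x,y)\ge 0$ for $x\ne y$ and $G(x,x)=-\sum_{y\ne x}G(x,y)$. Let $Y=(Y_t)_{t\ge 0}$ be the continuous-time Markov chain on $\mathbb S$ with right-continuous paths and rate matrix $\boldsymbol G$ (transition matrices $e^{t\boldsymbol G}$), and write $\mathbb E_x$ for the expectation when $Y_0=x$. Fix $a>0$ and $f:\mathbb S\to\mathbb C$, and put $$\tau_a=\inf\Big\{t\ge 0:\ \sup_{0\le u\le t}Y_u-Y_t\ge a\Big\},\qquad T_A=\inf\{t>0:\ Y_t\notin A\}\quad(A\subseteq\mathbb R),$$ with $\inf\emptyset=\infty$. For $k,g:\mathbb S\to\mathbb C$, $A\subseteq\mathbb R$ and $x\in\mathbb S$ define $$B(k,x)=\mathbb E_x\Big[e^{-\int_0^{\tau_a}k(Y_s)\,ds}\,\mathbf 1_{\{\tau_a<\infty\}}\,f(Y_{\tau_a})\Big],\qquad P_A(k,x;g)=\mathbb E_x\Big[e^{-\int_0^{T_A}k(Y_s)\,ds}\,\mathbf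 1_{\{T_A<\infty\}}\,g(Y_{T_A})\Big].$$ Then for every $k:\mathbb S\to\mathbb C$ with $\Re k(z)\ge 0$ for all $z\in\mathbb S$ and every $x\in\mathbb S$, the random variables in the expectations $B(k,y)$, $y\in\mathbb S$, and $P_{(x-a,x]}(k,x;g)$, $g:\mathbb S\to\mathbb C$, are integrable, and $$B(k,x)=P_{(x-a,x]}\big(k,x;\,f(\cdot)\mathbf 1_{\{\cdot\le x-a\}}\big)+\sum_{y\in\mathbb S,\ y>x}P_{(x-a,x]}\big(k,x;\,\mathbf 1_{\{\cdot=y\}}\big)\,B(k,y).$$ -/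

import Mathlib

open MeasureTheory
open scoped NNReal ENNReal

namespace CTMC

noncomputable section

/-- Transition rate matrices on a finite set of real states: nonnegative off-diagonal entries and
`G(x,x) = -∑_{y ≠ x} G(x,y)`. -/
structure IsRateMatrix {S : Finset ℝ} (G : Matrix S S ℝ) : Prop where
  nonneg_of_ne : ∀ x y : S, x ≠ y → 0 ≤ G x y
  diag_eq : ∀ x : S, G x x = -∑ y ∈ Finset.univ.erase x, G x y

/-- `Y` is, under the family `(P x)` of probability measures, the continuous-time Markov chain with
rate matrix `G`, started from `x` under `P x`: its paths are right-continuous, and its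
finite-dimensional distributions are those given by the transition matrices `exp (t G)`. -/
structure IsMarkovChain {Ω : Type*} [MeasurableSpace Ω] {S : Finset ℝ} (G : Matrix S S ℝ)
    (P : S → Measure Ω) (Y : ℝ≥0 → Ω → S) : Prop where
  isProbabilityMeasure : ∀ x, IsProbabilityMeasure (P x)
  measurable : ∀ t, Measurable (Y t)
  rightContinuous : ∀ ω t, ContinuousWithinAt (fun s => Y s ω) (Set.Ici t) t
  finiteDimensional : ∀ (x : S) (n : ℕ) (t : Fin (n + 1) → ℝ≥0) (y : Fin (n + 1) → S),
    Monotone t → t 0 = 0 →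
      (P x).real {ω | ∀ i, Y (t i) ω = y i} =
        (if y 0 = x then 1 else 0) *
          ∏ i : Fin n,
            NormedSpace.exp (((t i.succ : ℝ) - (t i.castSucc : ℝ)) • G) (y i.castSucc) (y i.succ)

section Functionals

variable {Ω : Type*} {S : Finset ℝ}

/-- The first passage time `T_A = inf {t > 0 : Y_t ∉ A}`, which is `∞` if there is no such `t`. -/
def firstPassageTime (Y : ℝ≥0 → Ω → S) (A : Set ℝ) (ω : Ω) : ℝ≥0∞ :=
  ⨅ (t : ℝ≥0) (_ : 0 < t ∧ (Y t ω : ℝ) ∉ A), (t : ℝ≥0∞)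

/-- The running maximum `sup_{0 ≤ u ≤ t} Y_u`. -/
def runningMax (Y : ℝ≥0 → Ω → S) (t : ℝ≥0) (ω : Ω) : ℝ :=
  sSup ((fun u => (Y u ω : ℝ)) '' Set.Iic t)

/-- The drawdown time `τ_a = inf {t ≥ 0 : sup_{0 ≤ u ≤ t} Y_u - Y_t ≥ a}`, which is `∞` if there is
no such `t`. -/
def drawdownTime (Y : ℝ≥0 → Ω → S) (a : ℝ) (ω : Ω) : ℝ≥0∞ :=
  ⨅ (t : ℝ≥0) (_ : a ≤ runningMax Y t ω - (Y t ω : ℝ)), (t : ℝ≥0∞)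

/-- The random variable `exp (-∫_0^T k(Y_s) ds) 1_{T < ∞} f(Y_T)` for a random time `T`. -/
def discountedPayoff (Y : ℝ≥0 → Ω → S) (T : Ω → ℝ≥0∞) (k f : S → ℂ) (ω : Ω) : ℂ :=
  open Classical in
  if T ω < ∞ then
    Complex.exp (-∫ s in (0 : ℝ)..(T ω).toReal, k (Y s.toNNReal ω)) * f (Y (T ω).toNNReal ω)
  else 0

variable [MeasurableSpace Ω]

/-- `P_A(k, x; f) = E_x[exp (-∫_0^{T_A} k(Y_s) ds) 1_{T_A < ∞} f(Y_{T_A})]`. -/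
def passageValue (P : S → Measure Ω) (Y : ℝ≥0 → Ω → S) (A : Set ℝ) (k : S → ℂ) (x : S)
    (f : S → ℂ) : ℂ :=
  ∫ ω, discountedPayoff Y (firstPassageTime Y A) k f ω ∂(P x)

/-- `B(k, x) = E_x[exp (-∫_0^{τ_a} k(Y_s) ds) 1_{τ_a < ∞} f(Y_{τ_a})]`. -/
def drawdownValue (P : S → Measure Ω) (Y : ℝ≥0 → Ω → S) (a : ℝ) (f : S → ℂ) (k : S → ℂ)
    (x : S) : ℂ :=
  ∫ ω, discountedPayoff Y (drawdownTime Y a) k f ω ∂(P x)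

end Functionals

end

end CTMC

/-!
Started at `x`, the path leaves `(x - a, x]` either at a state `≤ x - a`, which completes the
drawdown at that very moment, or at a state `y > x`, which is a new maximum, so that from then on
the drawdown is that of a path started at `y`. By the strong Markov property at the exit time, the
payoff collected in the second case splits in expectation into the product of the discounted
weight of `y` and the value at `y`.

The strong Markov property holds on the space of right-continuous paths: at a fixed time it is a
factorization of the finite-dimensional distributions, a stopping time with values in a grid is
fixed on each of countably many events, and rounding up to finer and finer grids reaches every
stopping time. The random variables are functions of the path, so its law carries the result over
to the chain.
-/

namespace CTMC

open Filter Topology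

/-! ### Random times on a grid -/

/-- `t` rounded up to the grid `ℕ / (n + 1)`. -/
noncomputable def roundUp (n : ℕ) (t : ℝ≥0) : ℝ≥0 := ⌈t * (n + 1)⌉₊ / (n + 1)

/-- `t` rounded down to the grid `ℕ / (n + 1)`. -/
noncomputable def roundDown (n : ℕ) (t : ℝ≥0) : ℝ≥0 := ⌊t * (n + 1)⌋₊ / (n + 1)

lemma roundUp_zero (n : ℕ) : roundUp n 0 = 0 := by simp [roundUp]

lemma le_roundUp (n : ℕ) (t : ℝ≥0) : t ≤ roundUp n t :=
  (le_div_iff₀ (by positivity)).2 (Nat.le_ceil _)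

lemma roundUp_le_add (n : ℕ) (t : ℝ≥0) : roundUp n t ≤ t + 1 / (n + 1) := by
  have hn : (0 : ℝ≥0) < n + 1 := by positivity
  rw [roundUp, div_le_iff₀ hn, add_mul, one_div_mul_cancel hn.ne']
  exact (Nat.ceil_lt_add_one zero_le).le

lemma roundDown_le (n : ℕ) (t : ℝ≥0) : roundDown n t ≤ t :=
  (div_le_iff₀ (by positivity)).2 (Nat.floor_le zero_le)

lemma roundUp_le_iff {n : ℕ} {t s : ℝ≥0} : roundUp n t ≤ s ↔ t ≤ roundDown n s := by
  rw [roundUp, roundDown, div_le_iff₀ (by positivity), le_div_iff₀ (by positivity),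
    ← Nat.le_floor_iff zero_le, Nat.ceil_le]

lemma tendsto_roundUp (t : ℝ≥0) : Tendsto (fun n => roundUp n t) atTop (𝓝[≥] t) := by
  refine tendsto_nhdsWithin_iff.2 ⟨?_, Eventually.of_forall fun n => le_roundUp n t⟩
  have hmesh : Tendsto (fun n : ℕ => (1 : ℝ≥0) / (n + 1)) atTop (𝓝 0) :=
    NNReal.tendsto_coe.1 (by simpa using tendsto_one_div_add_atTop_nhds_zero_nat (𝕜 := ℝ))
  have hupper : Tendsto (fun n : ℕ => t + 1 / ((n : ℝ≥0) + 1)) atTop (𝓝 t) := by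
    simpa using hmesh.const_add t
  exact tendsto_of_tendsto_of_tendsto_of_le_of_le tendsto_const_nhds hupper
    (fun n => le_roundUp n t) (fun n => roundUp_le_add n t)

section Discretize

variable {α : Type*} {T : α → ℝ≥0∞}

/-- The random time `T` rounded up to the grid `ℕ / (n + 1)`. -/
noncomputable def discretize (n : ℕ) (T : α → ℝ≥0∞) (ω : α) : ℝ≥0∞ :=
  open Classical in if T ω = ∞ then ∞ else roundUp n (T ω).toNNReal

lemma toNNReal_discretize (n : ℕ) (T : α → ℝ≥0∞) (ω : α) :
    (discretize n T ω).toNNReal = roundUp n (T ω).toNNReal := by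
  unfold discretize
  split_ifs with h
  · simp only [h, ENNReal.toNNReal_top, roundUp_zero]
  · exact ENNReal.toNNReal_coe _

lemma discretize_lt_top_iff {n : ℕ} {ω : α} : discretize n T ω < ∞ ↔ T ω < ∞ := by
  unfold discretize
  split_ifs with h
  · rw [h]
  · exact iff_of_true ENNReal.coe_lt_top (lt_top_iff_ne_top.2 h)

lemma discretize_le_iff {n : ℕ} {ω : α} {s : ℝ≥0} :
    discretize n T ω ≤ s ↔ T ω ≤ roundDown n s := by
  unfold discretize
  split_ifs with h
  · simp only [h, top_le_iff, ENNReal.coe_ne_top]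
  · rw [ENNReal.coe_le_coe, roundUp_le_iff, ← ENNReal.coe_le_coe, ENNReal.coe_toNNReal h]

lemma countable_range_discretize (n : ℕ) (T : α → ℝ≥0∞) :
    (Set.range (discretize n T)).Countable := by
  refine ((Set.countable_range fun j : ℕ => ((j / (n + 1) : ℝ≥0) : ℝ≥0∞)).insert ∞).mono ?_
  rintro _ ⟨ω, rfl⟩
  unfold discretize
  split_ifs
  · exact Set.mem_insert _ _
  · exact Set.mem_insert_of_mem _ ⟨_, rfl⟩

lemma measure_eq_tsum_of_countable_range [MeasurableSpace α] (μ : Measure α)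
    {σ : α → ℝ≥0∞} (hσ : Measurable σ) (hc : (Set.range σ).Countable) {A : Set α}
    (hA : MeasurableSet A) (hfin : ∀ ω ∈ A, σ ω < ∞) :
    μ A = ∑' s : ((↑) ⁻¹' Set.range σ : Set ℝ≥0), μ (A ∩ {ω | σ ω = (s : ℝ≥0)}) := by
  have hK : ((↑) ⁻¹' Set.range σ : Set ℝ≥0).Countable := hc.preimage ENNReal.coe_injective
  have hunion : A = ⋃ s ∈ ((↑) ⁻¹' Set.range σ : Set ℝ≥0), A ∩ {ω | σ ω = (s : ℝ≥0)} := by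
    ext ω
    simp only [Set.mem_iUnion, Set.mem_inter_iff, Set.mem_ofPred_eq, exists_prop]
    refine ⟨fun h => ?_, fun ⟨_, _, h, _⟩ => h⟩
    have hω : ((σ ω).toNNReal : ℝ≥0∞) = σ ω := ENNReal.coe_toNNReal (hfin ω h).ne
    exact ⟨(σ ω).toNNReal, ⟨ω, hω.symm⟩, h, hω.symm⟩
  conv_lhs => rw [hunion]
  refine measure_biUnion hK (fun s _ t _ hst => ?_) fun s _ =>
    hA.inter (hσ (measurableSet_singleton _))
  refine Set.disjoint_left.2 fun ω hs ht => hst ?_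
  exact ENNReal.coe_injective (hs.2.symm.trans ht.2)

end Discretize

/-- If `p t` persists for some time after each `t` at which it holds, then the first time at which
it holds can be computed along a countable dense set of times. -/
lemma measurable_iInf_time {α : Type*} [MeasurableSpace α] {p : ℝ≥0 → α → Prop}
    (hp : ∀ t, MeasurableSet {ω | p t ω}) (hright : ∀ t ω, p t ω → ∀ᶠ s in 𝓝[>] t, p s ω) :
    Measurable fun ω => ⨅ (t : ℝ≥0) (_ : p t ω), (t : ℝ≥0∞) := by
  obtain ⟨D, hDc, hD⟩ := TopologicalSpace.exists_countable_dense ℝ≥0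
  refine measurable_of_Iio fun r => ?_
  have heq : (fun ω => ⨅ (t : ℝ≥0) (_ : p t ω), (t : ℝ≥0∞)) ⁻¹' Set.Iio r =
      ⋃ q ∈ {q ∈ D | (q : ℝ≥0∞) < r}, {ω | p q ω} := by
    ext ω
    simp only [Set.mem_preimage, Set.mem_Iio, iInf_lt_iff, Set.mem_iUnion, exists_prop,
      Set.mem_ofPred_eq]
    constructor
    · rintro ⟨t, hpt, htr⟩
      have hlt : ∀ᶠ s : ℝ≥0 in 𝓝[>] t, (s : ℝ≥0∞) < r :=
        nhdsWithin_le_nhds (ENNReal.continuous_coe.continuousAt.eventually_lt_const htr)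
      obtain ⟨u, htu, hu⟩ := (mem_nhdsGT_iff_exists_Ioo_subset' (lt_add_one t)).1
        ((hright t ω hpt).and hlt)
      obtain ⟨q, hqD, hq⟩ := hD.exists_between htu
      exact ⟨q, ⟨hqD, (hu hq).2⟩, (hu hq).1⟩
    · rintro ⟨q, ⟨-, hqr⟩, hpq⟩
      exact ⟨q, hpq, hqr⟩
  rw [heq]
  exact MeasurableSet.biUnion (hDc.mono fun _ h => h.1) fun q _ => hp q

/-! ### Right-continuous paths -/

/-- Right-continuous paths `ℝ≥0 → E`, with the σ-algebra generated by the coordinates. -/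
abbrev PathSpace (E : Type*) [TopologicalSpace E] : Type _ :=
  {w : ℝ≥0 → E // ∀ t, ContinuousWithinAt w (Set.Ici t) t}

namespace PathSpace

section Topological

variable {E : Type*} [TopologicalSpace E]

instance : CoeFun (PathSpace E) fun _ => ℝ≥0 → E := ⟨Subtype.val⟩

/-- The coordinate maps of the path space, in the form of a process `Y t ω`. -/
abbrev coord (t : ℝ≥0) (w : PathSpace E) : E := w t

/-- The path stopped at time `s`. -/
def stopped (s : ℝ≥0) (w : PathSpace E) : PathSpace E :=
  ⟨fun t => w (min t s), fun t => (w.2 (min t s)).comp (f := (min · s))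
    (continuous_id.min continuous_const).continuousWithinAt fun _ hu => min_le_min_right s hu⟩

/-- The path shifted by time `s`. -/
def shift (s : ℝ≥0) (w : PathSpace E) : PathSpace E :=
  ⟨fun t => w (s + t), fun t => (w.2 (s + t)).comp (by fun_prop) fun _ hu => add_le_add_right hu s⟩

lemma stopped_apply (s : ℝ≥0) (w : PathSpace E) (t : ℝ≥0) : stopped s w t = w (min t s) := rfl

lemma shift_apply (s : ℝ≥0) (w : PathSpace E) (t : ℝ≥0) : shift s w t = w (s + t) := rfl

lemma stopped_stopped {q s : ℝ≥0} (hqs : q ≤ s) (w : PathSpace E) :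
    stopped q (stopped s w) = stopped q w :=
  Subtype.ext <| funext fun t => by
    simp only [stopped_apply, min_eq_left ((min_le_right t q).trans hqs)]

/-- The path up to the random time `T`. Like `future T`, it carries information about `T` only
where `T` is finite: where `T = ∞`, it is the path stopped at time `0`. -/
def past (T : PathSpace E → ℝ≥0∞) (w : PathSpace E) : PathSpace E := stopped (T w).toNNReal w

/-- The path after the random time `T`. -/
def future (T : PathSpace E → ℝ≥0∞) (w : PathSpace E) : PathSpace E := shift (T w).toNNReal w

/-- The event that the random time `T` is finite and the path is in the state `y` at time `T`. -/
def endsAt (T : PathSpace E → ℝ≥0∞) (y : E) : Set (PathSpace E) :=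
  {w | T w < ∞ ∧ w (T w).toNNReal = y}

/-- The set of paths through finitely many prescribed pairs of a time and a state. -/
def cylinder (F : Finset (ℝ≥0 × E)) : Set (PathSpace E) := {w | ∀ p ∈ F, w p.1 = p.2}

lemma mem_cylinder {F : Finset (ℝ≥0 × E)} {w : PathSpace E} :
    w ∈ cylinder F ↔ ∀ p ∈ F, w p.1 = p.2 := Iff.rfl

lemma cylinder_empty : cylinder (∅ : Finset (ℝ≥0 × E)) = Set.univ := by
  simp [cylinder]

lemma cylinder_union [DecidableEq E] (F H : Finset (ℝ≥0 × E)) :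
    cylinder (F ∪ H) = cylinder F ∩ cylinder H := by
  ext w
  simp only [mem_cylinder, Set.mem_inter_iff, Finset.forall_mem_union]

lemma cylinder_insert [DecidableEq E] (t : ℝ≥0) (y : E) (F : Finset (ℝ≥0 × E)) :
    cylinder (insert (t, y) F) = {w | w t = y} ∩ cylinder F := by
  ext w
  simp only [mem_cylinder, Finset.forall_mem_insert, Set.mem_inter_iff, Set.mem_ofPred_eq]

lemma preimage_stopped_cylinder [DecidableEq E] (s : ℝ≥0) (F : Finset (ℝ≥0 × E)) :
    stopped s ⁻¹' cylinder F = cylinder (F.image fun p => (min p.1 s, p.2)) := by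
  ext w
  simp only [Set.mem_preimage, mem_cylinder, stopped_apply, Finset.forall_mem_image]

lemma isPiSystem_range_cylinder : IsPiSystem (Set.range (cylinder (E := E))) := by
  classical
  rintro _ ⟨F, rfl⟩ _ ⟨H, rfl⟩ -
  exact ⟨F ∪ H, cylinder_union F H⟩

variable [DiscreteTopology E]

lemma eventually_eq (w : PathSpace E) (t : ℝ≥0) : ∀ᶠ s in 𝓝[≥] t, w s = w t :=
  (w.2 t).eventually ((isOpen_discrete {w t}).mem_nhds rfl)

lemma eventually_lt_and_eq (w : PathSpace E) (t : ℝ≥0) : ∀ᶠ s in 𝓝[>] t, t < s ∧ w s = w t := by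
  filter_upwards [self_mem_nhdsWithin,
    nhdsWithin_mono t Set.Ioi_subset_Ici_self (eventually_eq w t)] with s hts hs
  exact ⟨hts, hs⟩

lemma eventually_past_discretize_mem_cylinder_iff (T : PathSpace E → ℝ≥0∞)
    (F : Finset (ℝ≥0 × E)) (w : PathSpace E) :
    ∀ᶠ n in atTop, past (discretize n T) w ∈ cylinder F ↔ past T w ∈ cylinder F := by
  have hp : ∀ᶠ n in atTop, ∀ p ∈ F,
      w (min p.1 (roundUp n (T w).toNNReal)) = w (min p.1 (T w).toNNReal) := by
    refine (Filter.eventually_all_finset F).2 fun p _ => ?_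
    have hmin : Tendsto (min p.1) (𝓝[≥] (T w).toNNReal) (𝓝[≥] min p.1 (T w).toNNReal) :=
      (continuous_const.min continuous_id).continuousWithinAt.tendsto_nhdsWithin
        fun _ h => min_le_min_left p.1 h
    exact (hmin.comp (tendsto_roundUp _)).eventually (eventually_eq w _)
  filter_upwards [hp] with n hn
  simp only [mem_cylinder, past, stopped_apply, toNNReal_discretize]
  exact forall₂_congr fun p h => by rw [hn p h]

lemma eventually_future_discretize_mem_cylinder_iff (T : PathSpace E → ℝ≥0∞)
    (H : Finset (ℝ≥0 × E)) (w : PathSpace E) :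
    ∀ᶠ n in atTop, future (discretize n T) w ∈ cylinder H ↔ future T w ∈ cylinder H := by
  have hp : ∀ᶠ n in atTop, ∀ p ∈ H,
      w (roundUp n (T w).toNNReal + p.1) = w ((T w).toNNReal + p.1) := by
    refine (Filter.eventually_all_finset H).2 fun p _ => ?_
    have hadd : Tendsto (· + p.1) (𝓝[≥] (T w).toNNReal) (𝓝[≥] ((T w).toNNReal + p.1)) :=
      (continuous_id.add continuous_const).continuousWithinAt.tendsto_nhdsWithin
        fun _ h => add_le_add_left h p.1
    exact (hadd.comp (tendsto_roundUp _)).eventually (eventually_eq w _)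
  filter_upwards [hp] with n hn
  simp only [mem_cylinder, future, shift_apply, toNNReal_discretize]
  exact forall₂_congr fun p h => by rw [hn p h]

lemma eventually_mem_endsAt_discretize_iff (T : PathSpace E → ℝ≥0∞) (y : E) (w : PathSpace E) :
    ∀ᶠ n in atTop, w ∈ endsAt (discretize n T) y ↔ w ∈ endsAt T y := by
  filter_upwards [(tendsto_roundUp _).eventually (eventually_eq w (T w).toNNReal)] with n hn
  simp only [endsAt, Set.mem_ofPred_eq, discretize_lt_top_iff, toNNReal_discretize, hn]

end Topological

section Measurable

open TopologicalSpace

variable {E : Type*} [TopologicalSpace E] [MeasurableSpace E]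

lemma measurable_coord (t : ℝ≥0) : Measurable (coord (E := E) t) :=
  (measurable_pi_apply t).comp measurable_subtype_coe

variable [PseudoMetrizableSpace E] [BorelSpace E]

lemma measurable_uncurry_coord : Measurable fun p : ℝ≥0 × PathSpace E => p.2 p.1 := by
  refine measurable_of_tendsto_metrizable (f := fun n p => p.2 (roundUp n p.1)) (fun n => ?_)
    (tendsto_pi_nhds.2 fun p => (p.2.2 p.1).tendsto.comp (tendsto_roundUp p.1))
  have hgrid : Measurable fun p : ℕ × PathSpace E => p.2 (p.1 / (n + 1)) :=
    measurable_from_prod_countable_right fun j => measurable_coord (j / (n + 1))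
  have hindex : Measurable fun p : ℝ≥0 × PathSpace E => ⌈p.1 * (n + 1)⌉₊ :=
    Nat.measurable_ceil.comp (measurable_fst.mul_const _)
  exact hgrid.comp (hindex.prodMk measurable_snd)

lemma measurable_coord_comp {α : Type*} [MeasurableSpace α] {T : α → ℝ≥0} {X : α → PathSpace E}
    (hT : Measurable T) (hX : Measurable X) : Measurable fun ω => X ω (T ω) :=
  measurable_uncurry_coord.comp (hT.prodMk hX)

variable {T : PathSpace E → ℝ≥0∞}

lemma measurable_past (hT : Measurable T) : Measurable (past T) :=
  Measurable.subtype_mk <| measurable_pi_lambda _ fun _ =>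
    measurable_coord_comp (measurable_const.min hT.ennreal_toNNReal) measurable_id

lemma measurable_future (hT : Measurable T) : Measurable (future T) :=
  Measurable.subtype_mk <| measurable_pi_lambda _ fun _ =>
    measurable_coord_comp (hT.ennreal_toNNReal.add_const _) measurable_id

lemma measurableSet_endsAt [MeasurableSingletonClass E] (hT : Measurable T) (y : E) :
    MeasurableSet (endsAt T y) :=
  (measurableSet_lt hT measurable_const).inter
    (measurable_coord_comp hT.ennreal_toNNReal measurable_id (measurableSet_singleton y))

end Measurable

section Cylinders

variable {E : Type*} [TopologicalSpace E] [MeasurableSpace E]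

lemma measurableSet_coord_eq [MeasurableSingletonClass E] (t : ℝ≥0) (y : E) :
    MeasurableSet {w : PathSpace E | w t = y} :=
  measurable_coord t (measurableSet_singleton y)

lemma measurableSet_cylinder [MeasurableSingletonClass E] (F : Finset (ℝ≥0 × E)) :
    MeasurableSet (cylinder F) := by
  have : cylinder F = ⋂ p ∈ F, {w | w p.1 = p.2} := by
    ext w
    simp only [mem_cylinder, Set.mem_iInter, Set.mem_ofPred_eq]
  rw [this]
  exact F.measurableSet_biInter fun p _ => measurableSet_coord_eq p.1 p.2

lemma generateFrom_range_cylinder [Countable E] [MeasurableSingletonClass E] :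
    MeasurableSpace.generateFrom (Set.range (cylinder (E := E))) =
      (inferInstance : MeasurableSpace (PathSpace E)) := by
  refine le_antisymm (MeasurableSpace.generateFrom_le ?_) ?_
  · rintro _ ⟨F, rfl⟩
    exact measurableSet_cylinder F
  · let m := MeasurableSpace.generateFrom (Set.range (cylinder (E := E)))
    have hcoord : ∀ t, Measurable[m] (coord (E := E) t) := fun t =>
      @measurable_to_countable' _ _ _ _ m _ fun y =>
        MeasurableSpace.measurableSet_generateFrom ⟨{(t, y)}, by
          ext w
          simp only [mem_cylinder, Finset.mem_singleton, forall_eq, Set.mem_preimage,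
            Set.mem_singleton_iff]⟩
    exact (@measurable_pi_lambda _ _ _ m _ _ hcoord).comap_le

lemma eq_prod_of_forall_cylinder [Countable E] [MeasurableSingletonClass E]
    {ρ : Measure (PathSpace E × PathSpace E)} {μ ν : Measure (PathSpace E)} [IsFiniteMeasure μ]
    [IsFiniteMeasure ν]
    (h : ∀ F H, ρ (cylinder F ×ˢ cylinder H) = μ (cylinder F) * ν (cylinder H)) :
    ρ = μ.prod ν := by
  have spanning (η : Measure (PathSpace E)) [IsFiniteMeasure η] :
      η.FiniteSpanningSetsIn (Set.range cylinder) :=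
    ⟨fun _ => Set.univ, fun _ => ⟨∅, cylinder_empty⟩, fun _ => measure_lt_top _ _,
      Set.iUnion_const _⟩
  refine (Measure.prod_eq_generateFrom generateFrom_range_cylinder generateFrom_range_cylinder
    isPiSystem_range_cylinder isPiSystem_range_cylinder (spanning μ) (spanning ν) ?_).symm
  rintro _ ⟨F, rfl⟩ _ ⟨H, rfl⟩
  exact h F H

end Cylinders

/-! ### The strong Markov property -/

section Markov

variable {E : Type*} [TopologicalSpace E] [MeasurableSpace E]

/-- The (strong) Markov property of a family `Q` of laws, indexed by the initial state, at the
random time `T`: on the event that `T` is finite and the path is in the state `y` at time `T`, the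
path after `T` is independent of the path up to `T` and has the law `Q y`. -/
def HasMarkovPropertyAt (Q : E → Measure (PathSpace E)) (T : PathSpace E → ℝ≥0∞) : Prop :=
  ∀ x y, ((Q x).restrict (endsAt T y)).map (fun w => (past T w, future T w)) =
    (((Q x).restrict (endsAt T y)).map (past T)).prod (Q y)

/-- Stopping times of the raw filtration of the coordinates, in the form of Galmarino's test: the
path up to time `s` decides whether `T ≤ s`. -/
structure IsPathStoppingTime (T : PathSpace E → ℝ≥0∞) : Prop where
  measurable : Measurable T
  stopped_le_iff : ∀ w (s : ℝ≥0), T (stopped s w) ≤ s ↔ T w ≤ s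

namespace IsPathStoppingTime

variable {T : PathSpace E → ℝ≥0∞}

lemma stopped_le_iff_of_le (hT : IsPathStoppingTime T) {q s : ℝ≥0} (hqs : q ≤ s)
    (w : PathSpace E) : T (stopped s w) ≤ q ↔ T w ≤ q := by
  rw [← hT.stopped_le_iff (stopped s w) q, stopped_stopped hqs, hT.stopped_le_iff]

lemma stopped_eq_iff (hT : IsPathStoppingTime T) (w : PathSpace E) (s : ℝ≥0) :
    T (stopped s w) = s ↔ T w = s := by
  have key (u : ℝ≥0∞) : u = s ↔ u ≤ s ∧ ∀ q : ℝ≥0, q < s → ¬ u ≤ q := by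
    refine ⟨?_, fun ⟨hle, hlt⟩ => hle.antisymm <| le_of_not_gt fun h => ?_⟩
    · rintro rfl
      exact ⟨le_rfl, fun q hq => not_le.2 (ENNReal.coe_lt_coe.2 hq)⟩
    · lift u to ℝ≥0 using h.ne_top
      exact hlt u (ENNReal.coe_lt_coe.1 h) le_rfl
  rw [key, key, hT.stopped_le_iff]
  exact and_congr_right fun _ => forall₂_congr fun q hq =>
    not_congr (hT.stopped_le_iff_of_le hq.le w)

lemma endsAt_inter_past_inter_eq (hT : IsPathStoppingTime T) (y : E) (C : Set (PathSpace E))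
    (s : ℝ≥0) :
    endsAt T y ∩ past T ⁻¹' C ∩ {w | T w = s} =
      endsAt (fun _ => s) y ∩ past (fun _ => s) ⁻¹' ({w | T w = s} ∩ C) := by
  ext w
  simp only [endsAt, past, Set.mem_inter_iff, Set.mem_preimage, Set.mem_ofPred_eq,
    ENNReal.toNNReal_coe, hT.stopped_eq_iff]
  constructor
  · rintro ⟨⟨⟨-, hy⟩, hC⟩, hs⟩
    rw [hs, ENNReal.toNNReal_coe] at hy hC
    exact ⟨⟨ENNReal.coe_lt_top, hy⟩, hs, hC⟩
  · rintro ⟨⟨hfin, hy⟩, hs, hC⟩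
    rw [hs, ENNReal.toNNReal_coe]
    exact ⟨⟨⟨hfin, hy⟩, hC⟩, rfl⟩

lemma endsAt_inter_past_inter_future_inter_eq (hT : IsPathStoppingTime T) (y : E)
    (C D : Set (PathSpace E)) (s : ℝ≥0) :
    endsAt T y ∩ past T ⁻¹' C ∩ future T ⁻¹' D ∩ {w | T w = s} =
      endsAt (fun _ => s) y ∩ past (fun _ => s) ⁻¹' ({w | T w = s} ∩ C) ∩
        future (fun _ => s) ⁻¹' D := by
  rw [← hT.endsAt_inter_past_inter_eq, Set.inter_right_comm]
  ext w
  refine and_congr_right fun ⟨_, hs⟩ => ?_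
  rw [Set.mem_ofPred_eq] at hs
  simp only [Set.mem_preimage, future, hs]

end IsPathStoppingTime

variable {T : PathSpace E → ℝ≥0∞}

protected lemma IsPathStoppingTime.discretize (hT : IsPathStoppingTime T) (n : ℕ) :
    IsPathStoppingTime (discretize n T) where
  measurable := by
    have hround : Measurable (roundUp n) :=
      (measurable_of_countable fun j : ℕ => (j / (n + 1) : ℝ≥0)).comp
        (Nat.measurable_ceil.comp (measurable_id.mul_const _))
    exact Measurable.ite (hT.measurable (measurableSet_singleton ∞)) measurable_const
      (hround.comp hT.measurable.ennreal_toNNReal).coe_nnreal_ennreal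
  stopped_le_iff w s := by
    rw [discretize_le_iff, discretize_le_iff, hT.stopped_le_iff_of_le (roundDown_le n s)]

variable {Q : E → Measure (PathSpace E)}

section PseudoMetrizable

variable [TopologicalSpace.PseudoMetrizableSpace E] [BorelSpace E]

lemma HasMarkovPropertyAt.measure_inter (hQ : HasMarkovPropertyAt Q T) (hT : Measurable T)
    (x y : E) {C D : Set (PathSpace E)} (hC : MeasurableSet C) (hD : MeasurableSet D)
    [SFinite (Q y)] :
    Q x (endsAt T y ∩ past T ⁻¹' C ∩ future T ⁻¹' D) =
      Q x (endsAt T y ∩ past T ⁻¹' C) * Q y D := by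
  have hpast := measurable_past hT
  have hpair := hpast.prodMk (measurable_future hT)
  have h := congrArg (fun ρ => ρ (C ×ˢ D)) (hQ x y)
  simp only [Measure.prod_prod] at h
  rw [Measure.map_apply hpair (hC.prod hD), Measure.restrict_apply (hpair (hC.prod hD)),
    Measure.map_apply hpast hC, Measure.restrict_apply (hpast hC), Set.mk_preimage_prod] at h
  rwa [Set.inter_comm (endsAt T y), Set.inter_right_comm]

lemma HasMarkovPropertyAt.setIntegral_past_mul_future (hQ : HasMarkovPropertyAt Q T)
    (hT : Measurable T) (x y : E) [SFinite (Q x)] [SFinite (Q y)] {Φ Ψ : PathSpace E → ℂ}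
    (hΦ : Measurable Φ) (hΨ : Measurable Ψ) :
    ∫ w in endsAt T y, Φ (past T w) * Ψ (future T w) ∂(Q x) =
      (∫ w in endsAt T y, Φ (past T w) ∂(Q x)) * ∫ w, Ψ w ∂(Q y) := by
  have hpast := measurable_past hT
  have hpair := hpast.prodMk (measurable_future hT)
  have hΦΨ : Measurable fun p : PathSpace E × PathSpace E => Φ p.1 * Ψ p.2 :=
    (hΦ.comp measurable_fst).mul (hΨ.comp measurable_snd)
  rw [← integral_map hpast.aemeasurable hΦ.aestronglyMeasurable, ← integral_prod_mul, ← hQ x y,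
    integral_map hpair.aemeasurable hΦΨ.aestronglyMeasurable]

end PseudoMetrizable

variable [DiscreteTopology E] [BorelSpace E] [Countable E] [∀ x, IsFiniteMeasure (Q x)]

lemma hasMarkovPropertyAt_of_forall_cylinder (hT : Measurable T)
    (h : ∀ x y F H, Q x (endsAt T y ∩ past T ⁻¹' cylinder F ∩ future T ⁻¹' cylinder H) =
      Q x (endsAt T y ∩ past T ⁻¹' cylinder F) * Q y (cylinder H)) :
    HasMarkovPropertyAt Q T := by
  refine fun x y => eq_prod_of_forall_cylinder fun F H => ?_
  have hpast := measurable_past hT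
  have hpair := hpast.prodMk (measurable_future hT)
  have hF := measurableSet_cylinder F
  have hFH := hF.prod (measurableSet_cylinder H)
  rw [Measure.map_apply hpair hFH, Measure.restrict_apply (hpair hFH), Set.mk_preimage_prod,
    Measure.map_apply hpast hF, Measure.restrict_apply (hpast hF), Set.inter_comm _ (endsAt T y),
    ← Set.inter_assoc, h, Set.inter_comm (endsAt T y)]

lemma IsPathStoppingTime.hasMarkovPropertyAt_of_countable_range
    (hQ : ∀ s : ℝ≥0, HasMarkovPropertyAt Q fun _ => s) (hT : IsPathStoppingTime T)
    (hc : (Set.range T).Countable) : HasMarkovPropertyAt Q T := by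
  refine hasMarkovPropertyAt_of_forall_cylinder hT.measurable fun x y F H => ?_
  have hF := measurableSet_cylinder F
  have hH := measurableSet_cylinder H
  have hpast : MeasurableSet (endsAt T y ∩ past T ⁻¹' cylinder F) :=
    (measurableSet_endsAt hT.measurable y).inter (measurable_past hT.measurable hF)
  rw [measure_eq_tsum_of_countable_range (Q x) hT.measurable hc
      (hpast.inter (measurable_future hT.measurable hH)) fun w hw => hw.1.1.1,
    measure_eq_tsum_of_countable_range (Q x) hT.measurable hc hpast fun w hw => hw.1.1,
    ← ENNReal.tsum_mul_right]
  refine tsum_congr fun s => ?_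
  rw [hT.endsAt_inter_past_inter_future_inter_eq, hT.endsAt_inter_past_inter_eq]
  exact (hQ s).measure_inter measurable_const x y
    ((hT.measurable (measurableSet_singleton _)).inter hF) hH

/-- The property passes from the discretizations of `T` to `T` itself because right-continuous paths
in a discrete space are constant just after each time. -/
theorem IsPathStoppingTime.hasMarkovPropertyAt (hQ : ∀ s : ℝ≥0, HasMarkovPropertyAt Q fun _ => s)
    (hT : IsPathStoppingTime T) : HasMarkovPropertyAt Q T := by
  refine hasMarkovPropertyAt_of_forall_cylinder hT.measurable fun x y F H => ?_
  have hF := measurableSet_cylinder F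
  have hH := measurableSet_cylinder H
  have hpast (n : ℕ) :
      MeasurableSet (endsAt (discretize n T) y ∩ past (discretize n T) ⁻¹' cylinder F) :=
    (measurableSet_endsAt (hT.discretize n).measurable y).inter
      (measurable_past (hT.discretize n).measurable hF)
  have lim_past := tendsto_measure_of_tendsto_indicator_of_isFiniteMeasure atTop (Q x)
    (A := endsAt T y ∩ past T ⁻¹' cylinder F) hpast fun w => by
      filter_upwards [eventually_mem_endsAt_discretize_iff T y w,
        eventually_past_discretize_mem_cylinder_iff T F w] with n hy hF
      exact and_congr hy hF
  have lim_both := tendsto_measure_of_tendsto_indicator_of_isFiniteMeasure atTop (Q x)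
    (A := endsAt T y ∩ past T ⁻¹' cylinder F ∩ future T ⁻¹' cylinder H)
    (fun n => (hpast n).inter (measurable_future (hT.discretize n).measurable hH)) fun w => by
      filter_upwards [eventually_mem_endsAt_discretize_iff T y w,
        eventually_past_discretize_mem_cylinder_iff T F w,
        eventually_future_discretize_mem_cylinder_iff T H w] with n hy hF hH
      exact and_congr (and_congr hy hF) hH
  refine tendsto_nhds_unique lim_both ?_
  refine (ENNReal.Tendsto.mul_const lim_past (Or.inr (measure_ne_top _ _))).congr fun n => ?_
  exact (((hT.discretize n).hasMarkovPropertyAt_of_countable_range hQ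
    (countable_range_discretize n T)).measure_inter (hT.discretize n).measurable x y hF hH).symm

end Markov

section FiniteDimensional

lemma exists_monotone_enumeration {α : Type*} [LinearOrder α] {I : Finset α} {a b : α}
    (ha : IsLeast (I : Set α) a) (hb : IsGreatest (I : Set α) b) :
    ∃ (n : ℕ) (t : ℕ → α), Monotone t ∧ t 0 = a ∧ t n = b ∧ t '' Set.Iic n = I := by
  obtain ⟨n, hn⟩ : ∃ n, I.card = n + 1 :=
    Nat.exists_eq_add_one.2 (Finset.card_pos.2 ⟨a, ha.1⟩)
  let e := I.orderEmbOfFin hn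
  let t : ℕ → α := fun i => e ⟨min i n, Nat.lt_succ_of_le (min_le_right i n)⟩
  have hmono : Monotone t := fun i j hij => e.monotone <| Fin.mk_le_mk.2 (min_le_min_right n hij)
  have himage : t '' Set.Iic n = I := by
    rw [← I.range_orderEmbOfFin hn]
    refine Set.Subset.antisymm ?_ ?_
    · rintro _ ⟨i, -, rfl⟩
      exact ⟨_, rfl⟩
    · rintro _ ⟨i, rfl⟩
      exact ⟨i, i.is_le, congrArg e (Fin.ext (min_eq_left i.is_le))⟩
  have hbounds (u : α) (hu : u ∈ I) : t 0 ≤ u ∧ u ≤ t n := by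
    obtain ⟨i, hi, rfl⟩ := himage.symm.subset hu
    exact ⟨hmono (Nat.zero_le i), hmono hi⟩
  refine ⟨n, t, hmono, ?_, ?_, himage⟩
  · exact (hbounds a ha.1).1.antisymm (ha.2 (himage.subset ⟨0, Nat.zero_le n, rfl⟩))
  · exact (hb.2 (himage.subset ⟨n, Set.self_mem_Iic, rfl⟩)).antisymm (hbounds b hb.1).2

/-- The sequence `f 0, …, f (n - 1), g 0, g 1, …`. -/
def concat {α : Type*} (n : ℕ) (f g : ℕ → α) (i : ℕ) : α := if i < n then f i else g (i - n)

lemma concat_add {α : Type*} (n : ℕ) (f g : ℕ → α) (j : ℕ) : concat n f g (n + j) = g j := by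
  simp [concat]

lemma concat_of_le {α : Type*} {n i : ℕ} {f g : ℕ → α} (h : f n = g 0) (hi : i ≤ n) :
    concat n f g i = f i := by
  rcases hi.lt_or_eq with hi | rfl
  · exact if_pos hi
  · exact (concat_add i f g 0).trans h.symm

lemma monotone_concat {α : Type*} [Preorder α] {n : ℕ} {f g : ℕ → α} (h : f n = g 0)
    (hf : Monotone f) (hg : Monotone g) : Monotone (concat n f g) := by
  refine monotone_nat_of_le_succ fun i => ?_
  rcases lt_or_ge i n with hi | hi
  · rw [concat_of_le h hi.le, concat_of_le h hi]
    exact hf i.le_succ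
  · obtain ⟨j, rfl⟩ := Nat.exists_eq_add_of_le hi
    rw [add_assoc, concat_add, concat_add]
    exact hg j.le_succ

lemma forall_le_concat_iff {E : Type*} [TopologicalSpace E] {n m : ℕ} {t r : ℕ → ℝ≥0} {s : ℝ≥0}
    {y z : ℕ → E} (ht : t n = s + r 0) (hy : y n = z 0) (w : PathSpace E) :
    (∀ i ≤ n + m, w (concat n t (fun j => s + r j) i) = concat n y z i) ↔
      (∀ i ≤ n, w (t i) = y i) ∧ ∀ j ≤ m, shift s w (r j) = z j := by
  constructor
  · refine fun h => ⟨fun i hi => ?_, fun j hj => ?_⟩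
    · simpa only [concat_of_le (g := fun j => s + r j) ht hi, concat_of_le hy hi] using
        h i (hi.trans (n.le_add_right m))
    · simpa only [concat_add, shift_apply] using h (n + j) (Nat.add_le_add_left hj n)
  · rintro ⟨hbefore, hafter⟩ i hi
    rcases le_total i n with hin | hin
    · rw [concat_of_le ht hin, concat_of_le hy hin, hbefore i hin]
    · obtain ⟨j, rfl⟩ := Nat.exists_eq_add_of_le hin
      rw [concat_add, concat_add]
      exact hafter j (Nat.add_le_add_iff_left.1 hi)

variable {S : Finset ℝ} {G : Matrix S S ℝ} {Q : S → Measure (PathSpace S)}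

/-- The probability that the chain passes through the states `y 1, …, y n` at the times
`t 1, …, t n`, given that it is in `y 0` at time `t 0`. -/
noncomputable def transitionProd (G : Matrix S S ℝ) (n : ℕ) (t : ℕ → ℝ≥0) (y : ℕ → S) : ℝ :=
  ∏ i ∈ Finset.range n, NormedSpace.exp (((t (i + 1) : ℝ) - (t i : ℝ)) • G) (y i) (y (i + 1))

lemma transitionProd_const_add (G : Matrix S S ℝ) (n : ℕ) (s : ℝ≥0) (t : ℕ → ℝ≥0) (y : ℕ → S) :
    transitionProd G n (fun i => s + t i) y = transitionProd G n t y := by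
  simp only [transitionProd, NNReal.coe_add, add_sub_add_left_eq_sub]

lemma transitionProd_concat (G : Matrix S S ℝ) {n m : ℕ} {t r : ℕ → ℝ≥0} {y z : ℕ → S}
    (ht : t n = r 0) (hy : y n = z 0) :
    transitionProd G (n + m) (concat n t r) (concat n y z) =
      transitionProd G n t y * transitionProd G m r z := by
  rw [transitionProd, Finset.prod_range_add]
  congr 1
  · refine Finset.prod_congr rfl fun i hi => ?_
    have hi' := Finset.mem_range.1 hi
    rw [concat_of_le ht hi'.le, concat_of_le ht hi', concat_of_le hy hi'.le, concat_of_le hy hi']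
  · exact Finset.prod_congr rfl fun j _ => by simp only [add_assoc, concat_add]

lemma measureReal_forall_le (hQ : IsMarkovChain G Q coord) (x : S) (n : ℕ) {t : ℕ → ℝ≥0}
    (ht : Monotone t) (h0 : t 0 = 0) (y : ℕ → S) :
    (Q x).real {w | ∀ i ≤ n, w (t i) = y i} =
      (if y 0 = x then 1 else 0) * transitionProd G n t y := by
  have h := hQ.finiteDimensional x n (fun i => t i) (fun i => y i) (fun i j hij => ht hij) h0
  simp only [Fin.forall_iff, Nat.lt_succ_iff] at h
  rw [h, transitionProd, Finset.prod_range]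
  rfl

lemma ae_coord_zero (hQ : IsMarkovChain G Q coord) (x : S) : ∀ᵐ w ∂(Q x), w 0 = x := by
  have := hQ.isProbabilityMeasure x
  have h := measureReal_forall_le hQ x 0 (t := fun _ => 0) monotone_const rfl fun _ => x
  simp only [Nat.le_zero, forall_eq, transitionProd, Finset.prod_range_zero, if_true, mul_one] at h
  refine (prob_compl_eq_zero_iff (measurableSet_coord_eq 0 x)).2 ?_
  rw [← ofReal_measureReal (measure_ne_top _ _), h, ENNReal.ofReal_one]

lemma cylinder_eq_of_mem {E : Type*} [TopologicalSpace E] {F : Finset (ℝ≥0 × E)}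
    {w₁ : PathSpace E} (hw₁ : w₁ ∈ cylinder F) {n : ℕ} {t : ℕ → ℝ≥0}
    (ht : t '' Set.Iic n = (F.image Prod.fst : Finset ℝ≥0)) :
    cylinder F = {w | ∀ i ≤ n, w (t i) = w₁ (t i)} := by
  ext w
  have hiff : (∀ u ∈ t '' Set.Iic n, w u = w₁ u) ↔ ∀ p ∈ F, w p.1 = w₁ p.1 := by
    rw [ht]
    simp only [Finset.mem_coe, Finset.forall_mem_image]
  rw [Set.forall_mem_image] at hiff
  refine Iff.trans ?_ hiff.symm
  exact forall₂_congr fun p hp => by rw [hw₁ p hp]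

lemma measureReal_cylinder_inter_preimage_shift (hQ : IsMarkovChain G Q coord) {x y : S}
    {s : ℝ≥0} {F H : Finset (ℝ≥0 × S)} (hF0 : (0, x) ∈ F) (hFs : (s, y) ∈ F)
    (hF : ∀ p ∈ F, p.1 ≤ s) (hH0 : (0, y) ∈ H) :
    (Q x).real (cylinder F ∩ shift s ⁻¹' cylinder H) =
      (Q x).real (cylinder F) * (Q y).real (cylinder H) := by
  rcases (cylinder F).eq_empty_or_nonempty with hempty | ⟨w₁, hw₁⟩
  · simp [hempty]
  rcases (cylinder H).eq_empty_or_nonempty with hempty | ⟨w₂, hw₂⟩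
  · simp [hempty]
  obtain ⟨n, t, htm, ht0, htn, htF⟩ := exists_monotone_enumeration (I := F.image Prod.fst)
    (a := 0) (b := s) ⟨Finset.mem_image_of_mem _ hF0, fun _ _ => zero_le⟩
    ⟨Finset.mem_image_of_mem _ hFs, Finset.forall_mem_image.2 hF⟩
  obtain ⟨m, r, hrm, hr0, -, hrH⟩ := exists_monotone_enumeration (I := H.image Prod.fst)
    (a := 0) ⟨Finset.mem_image_of_mem _ hH0, fun _ _ => zero_le⟩
    ((H.image Prod.fst).isGreatest_max' ⟨0, Finset.mem_image_of_mem Prod.fst hH0⟩)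
  have hjoin : t n = s + r 0 := by rw [htn, hr0, add_zero]
  have hstate : w₁ (t n) = w₂ (r 0) := by rw [htn, hr0, hw₁ _ hFs, hw₂ _ hH0]
  have hinter : cylinder F ∩ shift s ⁻¹' cylinder H = {w | ∀ i ≤ n + m,
      w (concat n t (fun j => s + r j) i) =
        concat n (fun i => w₁ (t i)) (fun j => w₂ (r j)) i} := by
    rw [cylinder_eq_of_mem hw₁ htF, cylinder_eq_of_mem hw₂ hrH]
    ext w
    exact (forall_le_concat_iff hjoin hstate w).symm
  have hF0' : w₁ (t 0) = x := by rw [ht0, hw₁ _ hF0]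
  have hH0' : w₂ (r 0) = y := by rw [hr0, hw₂ _ hH0]
  rw [hinter, measureReal_forall_le hQ x (n + m)
      (monotone_concat hjoin htm fun i j hij => add_le_add_right (hrm hij) s)
      ((concat_of_le hjoin n.zero_le).trans ht0), transitionProd_concat G hjoin hstate,
    transitionProd_const_add, concat_of_le hstate n.zero_le, cylinder_eq_of_mem hw₁ htF,
    cylinder_eq_of_mem hw₂ hrH, measureReal_forall_le hQ x n htm ht0,
    measureReal_forall_le hQ y m hrm hr0, if_pos hF0', if_pos hH0', one_mul, one_mul, one_mul]

lemma measure_coord_zero_inter (hQ : IsMarkovChain G Q coord) (x : S) (A : Set (PathSpace S)) :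
    Q x ({w | w 0 = x} ∩ A) = Q x A :=
  measure_congr <| by
    filter_upwards [ae_coord_zero hQ x] with w hw
    exact propext (and_iff_right hw)

/-- By the finite-dimensional distributions, prescribing also the states at the times `0` and `s`
turns both events into cylinders that split at time `s`. -/
lemma hasMarkovPropertyAt_const (hQ : IsMarkovChain G Q coord) (s : ℝ≥0) :
    HasMarkovPropertyAt Q fun _ => s := by
  have := hQ.isProbabilityMeasure
  refine hasMarkovPropertyAt_of_forall_cylinder measurable_const fun x y F H => ?_
  set A : Set (PathSpace S) := endsAt (fun _ => s) y ∩ past (fun _ => s) ⁻¹' cylinder F with hA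
  set F' : Finset (ℝ≥0 × S) := insert (0, x) (insert (s, y) (F.image fun p => (min p.1 s, p.2)))
  have hF' : cylinder F' = {w | w 0 = x} ∩ A := by
    rw [cylinder_insert, cylinder_insert, ← preimage_stopped_cylinder, hA]
    simp only [endsAt, ENNReal.coe_lt_top, ENNReal.toNNReal_coe, true_and]
    rfl
  have hH' : cylinder (insert (0, y) H) = {w | w 0 = y} ∩ cylinder H := cylinder_insert 0 y H
  have hinter : cylinder F' ∩ shift s ⁻¹' cylinder (insert (0, y) H) =
      {w | w 0 = x} ∩ (A ∩ future (fun _ => s) ⁻¹' cylinder H) := by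
    rw [hF', hH', Set.inter_assoc]
    ext w
    refine and_congr_right fun _ => and_congr_right fun hw => and_iff_right ?_
    exact (congrArg w (add_zero s)).trans hw.1.2
  have key := measureReal_cylinder_inter_preimage_shift hQ (F := F') (H := insert (0, y) H)
    (Finset.mem_insert_self _ _) (Finset.mem_insert_of_mem (Finset.mem_insert_self _ _))
    (by simp only [F', Finset.forall_mem_insert, Finset.forall_mem_image, zero_le, le_refl,
      min_le_right, implies_true, and_self]) (Finset.mem_insert_self _ _)
  rw [hinter] at key
  simp only [hF', hH', measureReal_def, measure_coord_zero_inter hQ, ← ENNReal.toReal_mul] at key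
  exact (ENNReal.toReal_eq_toReal_iff' (measure_ne_top _ _)
    (ENNReal.mul_ne_top (measure_ne_top _ _) (measure_ne_top _ _))).1 key

end FiniteDimensional

variable {S : Finset ℝ}

/-! ### First passage and drawdown times -/

section FirstPassage

lemma firstPassageTime_le_iff {A : Set ℝ} {w : PathSpace S} {t : ℝ≥0} :
    firstPassageTime coord A w ≤ t ↔ ∃ u ≤ t, (w u : ℝ) ∉ A := by
  constructor
  · contrapose!
    intro hA
    obtain ⟨r, htr, hr⟩ := (mem_nhdsGE_iff_exists_Ico_subset' (lt_add_one t)).1 (eventually_eq w t)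
    refine (ENNReal.coe_lt_coe.2 htr).trans_le (le_iInf₂ fun u hu => ENNReal.coe_le_coe.2 ?_)
    by_contra! hur
    rcases le_total u t with hut | htu
    · exact hu.2 (hA u hut)
    · have hwu : w u = w t := hr ⟨htu, hur⟩
      exact hu.2 (by simpa only [coord, hwu] using hA t le_rfl)
  · rintro ⟨u, hut, hu⟩
    -- The infimum omits the time `0`, so `u` is approached from the right.
    refine le_trans ?_ (ENNReal.coe_le_coe.2 hut)
    refine ge_of_tendsto (x := 𝓝[>] u)
      (ENNReal.continuous_coe.continuousAt.mono_left nhdsWithin_le_nhds) ?_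
    filter_upwards [eventually_lt_and_eq w u] with s ⟨hus, hs⟩
    exact iInf₂_le s ⟨pos_of_gt hus, by rwa [coord, hs]⟩

lemma coord_mem_of_lt_firstPassageTime {A : Set ℝ} {w : PathSpace S} {u : ℝ≥0}
    (h : u < firstPassageTime coord A w) : (w u : ℝ) ∈ A := by
  by_contra hu
  exact h.not_ge (firstPassageTime_le_iff.2 ⟨u, le_rfl, hu⟩)

lemma coord_notMem_of_firstPassageTime_eq {A : Set ℝ} {w : PathSpace S} {t : ℝ≥0}
    (h : firstPassageTime coord A w = t) : (w t : ℝ) ∉ A := by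
  obtain ⟨u, hut, hu⟩ := firstPassageTime_le_iff.1 h.le
  rcases hut.eq_or_lt with rfl | hlt
  · exact hu
  · exact absurd (coord_mem_of_lt_firstPassageTime (h ▸ ENNReal.coe_lt_coe.2 hlt)) hu

lemma measurable_firstPassageTime (A : Set ℝ) :
    Measurable (firstPassageTime (coord (E := S)) A) := by
  refine measurable_iInf_time (fun t => ?_) fun t w ⟨h0, hA⟩ => ?_
  · exact (MeasurableSet.const _).inter
      (measurable_coord t {z : S | (z : ℝ) ∉ A}.toFinite.measurableSet)
  · filter_upwards [eventually_lt_and_eq w t] with s ⟨hts, hs⟩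
    exact ⟨h0.trans hts, by rwa [coord, hs]⟩

lemma isPathStoppingTime_firstPassageTime (A : Set ℝ) :
    IsPathStoppingTime (firstPassageTime (coord (E := S)) A) where
  measurable := measurable_firstPassageTime A
  stopped_le_iff w s := by
    rw [firstPassageTime_le_iff, firstPassageTime_le_iff]
    refine exists_congr fun u => and_congr_right fun hu => ?_
    rw [stopped_apply, min_eq_left hu]

end FirstPassage

section Drawdown

lemma le_runningMax_iff {c : ℝ} {t : ℝ≥0} {w : PathSpace S} :
    c ≤ runningMax coord t w ↔ ∃ u ≤ t, c ≤ (w u : ℝ) := by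
  have hfin : ((fun u => (w u : ℝ)) '' Set.Iic t).Finite :=
    S.finite_toSet.subset (by rintro _ ⟨u, -, rfl⟩; exact (w u).2)
  constructor
  · intro hc
    obtain ⟨u, hu, hmax⟩ := (Set.nonempty_Iic.image _).csSup_mem hfin
    exact ⟨u, hu, hc.trans_eq hmax.symm⟩
  · rintro ⟨u, hu, hc⟩
    exact hc.trans (le_csSup hfin.bddAbove ⟨u, hu, rfl⟩)

lemma coord_le_runningMax {u t : ℝ≥0} (hut : u ≤ t) (w : PathSpace S) :
    (w u : ℝ) ≤ runningMax coord t w :=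
  le_runningMax_iff.2 ⟨u, hut, le_rfl⟩

lemma runningMax_mono (w : PathSpace S) : Monotone fun t => runningMax coord t w := by
  intro s t hst
  obtain ⟨u, hus, hu⟩ := le_runningMax_iff.1 (le_refl (runningMax coord s w))
  exact le_runningMax_iff.2 ⟨u, hus.trans hst, hu⟩

lemma runningMax_add {t : ℝ≥0} {w : PathSpace S} (hrecord : ∀ u ≤ t, w u ≤ w t) (v : ℝ≥0) :
    runningMax coord (t + v) w = runningMax coord v (shift t w) := by
  refine eq_of_forall_le_iff fun c => ?_
  rw [le_runningMax_iff, le_runningMax_iff]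
  constructor
  · rintro ⟨u, hu, hc⟩
    rcases le_total u t with hut | htu
    · exact ⟨0, zero_le, hc.trans (by simpa only [shift_apply, add_zero] using! hrecord u hut)⟩
    · obtain ⟨v', rfl⟩ := exists_add_of_le htu
      exact ⟨v', le_of_add_le_add_left hu, hc⟩
  · rintro ⟨u, hu, hc⟩
    exact ⟨t + u, add_le_add_right hu t, hc⟩

lemma measurable_runningMax (t : ℝ≥0) : Measurable (runningMax (coord (E := S)) t) := by
  refine measurable_of_Ici fun c => ?_
  have heq : runningMax (coord (E := S)) t ⁻¹' Set.Ici c =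
      {w | firstPassageTime coord (Set.Iio c) w ≤ t} := by
    ext w
    simp only [Set.mem_preimage, Set.mem_Ici, le_runningMax_iff, Set.mem_ofPred_eq,
      firstPassageTime_le_iff, Set.mem_Iio, not_lt]
  rw [heq]
  exact measurableSet_le (measurable_firstPassageTime _) measurable_const

lemma measurable_drawdownTime (a : ℝ) : Measurable (drawdownTime (coord (E := S)) a) := by
  refine measurable_iInf_time (fun t => ?_) fun t w ht => ?_
  · exact measurableSet_le measurable_const
      ((measurable_runningMax t).sub (measurable_subtype_coe.comp (measurable_coord t)))
  · filter_upwards [eventually_lt_and_eq w t] with s ⟨hts, hs⟩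
    rw [coord, hs]
    exact ht.trans (sub_le_sub_right (runningMax_mono w hts.le) _)

lemma drawdownTime_le {a : ℝ} {w : PathSpace S} {u t : ℝ≥0} (hut : u ≤ t)
    (h : (w t : ℝ) ≤ w u - a) : drawdownTime coord a w ≤ t := by
  refine iInf₂_le t ?_
  have := coord_le_runningMax hut w
  linarith

lemma firstPassageTime_le_drawdownTime (a x : ℝ) (w : PathSpace S) :
    firstPassageTime coord (Set.Ioc (x - a) x) w ≤ drawdownTime coord a w := by
  refine le_iInf₂ fun t ht => firstPassageTime_le_iff.2 ?_
  obtain ⟨u, hut, hu⟩ := le_runningMax_iff.1 (le_sub_iff_add_le.1 ht)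
  by_contra! hmem
  linarith [(hmem t le_rfl).1, (hmem u hut).2]

lemma drawdownTime_eq_add_shift {a : ℝ} {t : ℝ≥0} {w : PathSpace S}
    (hrecord : ∀ u ≤ t, w u ≤ w t) (ht : t ≤ drawdownTime coord a w) :
    drawdownTime coord a w = t + drawdownTime coord a (shift t w) := by
  refine le_antisymm ?_ (le_iInf₂ fun s hs => ?_)
  · refine tsub_le_iff_left.1 (le_iInf₂ fun v hv => tsub_le_iff_left.2 ?_)
    rw [← ENNReal.coe_add]
    refine iInf₂_le (t + v) ?_
    rwa [runningMax_add hrecord]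
  · obtain ⟨v, rfl⟩ := exists_add_of_le (ENNReal.coe_le_coe.1 (ht.trans (iInf₂_le s hs)))
    rw [runningMax_add hrecord] at hs
    rw [ENNReal.coe_add]
    exact add_le_add_right (iInf₂_le v hs) _

end Drawdown

/-! ### Discounted payoffs -/

section Discount

/-- The discount factor `exp (-∫_0^t k(w_s) ds)` accumulated along the path up to time `t`. -/
noncomputable def discount (k : S → ℂ) (t : ℝ≥0) (w : PathSpace S) : ℂ :=
  Complex.exp (-∫ s in (0 : ℝ)..t, k (w s.toNNReal))

lemma measurable_discount_integrand (k : S → ℂ) :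
    Measurable fun p : PathSpace S × ℝ => k (p.1 p.2.toNNReal) :=
  (measurable_of_finite k).comp (measurable_coord_comp measurable_snd.real_toNNReal measurable_fst)

lemma intervalIntegrable_discount_integrand (k : S → ℂ) (w : PathSpace S) (b c : ℝ) :
    IntervalIntegrable (fun s : ℝ => k (w s.toNNReal)) volume b c :=
  (intervalIntegrable_const (c := ‖k‖)).mono_fun
    ((measurable_discount_integrand k).comp measurable_prodMk_left).aestronglyMeasurable
    (Eventually.of_forall fun s => by simpa only [norm_norm] using norm_le_pi_norm k _)

lemma discount_add (k : S → ℂ) (t r : ℝ≥0) (w : PathSpace S) :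
    discount k (t + r) w = discount k t w * discount k r (shift t w) := by
  have hshift : ∫ s in (t : ℝ)..(t + r : ℝ≥0), k (w s.toNNReal) =
      ∫ s in (0 : ℝ)..r, k (shift t w s.toNNReal) := by
    have h := intervalIntegral.integral_comp_add_left (a := 0) (b := r)
      (fun s : ℝ => k (w s.toNNReal)) t
    rw [add_zero, ← NNReal.coe_add] at h
    rw [← h]
    refine intervalIntegral.integral_congr fun s hs => ?_
    rw [Set.uIcc_of_le r.coe_nonneg] at hs
    simp only [shift_apply, Real.toNNReal_add t.coe_nonneg hs.1, Real.toNNReal_coe]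
  rw [discount, discount, discount, ← Complex.exp_add, ← neg_add, ← hshift,
    intervalIntegral.integral_add_adjacent_intervals (intervalIntegrable_discount_integrand k w 0 t)
      (intervalIntegrable_discount_integrand k w t _)]

lemma discount_stopped (k : S → ℂ) (t : ℝ≥0) (w : PathSpace S) :
    discount k t (stopped t w) = discount k t w := by
  unfold discount
  congr 2
  refine intervalIntegral.integral_congr fun s hs => ?_
  rw [Set.uIcc_of_le t.coe_nonneg] at hs
  simp only [stopped_apply, min_eq_left (Real.toNNReal_le_iff_le_coe.2 hs.2)]

lemma norm_discount_le_one {k : S → ℂ} (hk : ∀ z, 0 ≤ (k z).re) (t : ℝ≥0) (w : PathSpace S) :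
    ‖discount k t w‖ ≤ 1 := by
  have hre : (∫ s in (0 : ℝ)..t, k (w s.toNNReal)).re = ∫ s in (0 : ℝ)..t, (k (w s.toNNReal)).re :=
    (Complex.reCLM.intervalIntegral_comp_comm (intervalIntegrable_discount_integrand k w 0 t)).symm
  rw [discount, Complex.norm_exp, Real.exp_le_one_iff, Complex.neg_re, neg_nonpos, hre]
  exact intervalIntegral.integral_nonneg t.coe_nonneg fun s _ => hk _

lemma measurable_discount (k : S → ℂ) {T : PathSpace S → ℝ≥0} (hT : Measurable T) :
    Measurable fun w => discount k (T w) w := by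
  have hindicator (w : PathSpace S) : ∫ s in (0 : ℝ)..T w, k (w s.toNNReal) =
      ∫ s, {p : PathSpace S × ℝ | p.2 ∈ Set.Ioc 0 (T p.1 : ℝ)}.indicator
        (fun p => k (p.1 p.2.toNNReal)) (w, s) := by
    rw [intervalIntegral.integral_of_le (T w).coe_nonneg, ← integral_indicator measurableSet_Ioc]
    rfl
  have hset : MeasurableSet {p : PathSpace S × ℝ | p.2 ∈ Set.Ioc 0 (T p.1 : ℝ)} :=
    (measurableSet_lt measurable_const measurable_snd).inter
      (measurableSet_le measurable_snd (hT.comp measurable_fst).coe_nnreal_real)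
  simp only [discount, hindicator]
  exact Complex.measurable_exp.comp ((measurable_discount_integrand k).indicator
    hset).stronglyMeasurable.integral_prod_right'.measurable.neg

end Discount

section Payoff

variable {T : PathSpace S → ℝ≥0∞} {k f : S → ℂ} {w : PathSpace S}

lemma discountedPayoff_of_eq_coe {t : ℝ≥0} (h : T w = t) :
    discountedPayoff coord T k f w = discount k t w * f (w t) := by
  rw [discountedPayoff, if_pos (h ▸ ENNReal.coe_lt_top), h, ENNReal.coe_toReal,
    ENNReal.toNNReal_coe, discount]

lemma discountedPayoff_of_eq_top (h : T w = ∞) : discountedPayoff coord T k f w = 0 :=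
  if_neg h.not_lt

lemma discountedPayoff_of_eq_add {σ τ : PathSpace S → ℝ≥0∞} {t : ℝ≥0}
    (h : τ w = t + σ (shift t w)) :
    discountedPayoff coord τ k f w =
      discount k t w * discountedPayoff coord σ k f (shift t w) := by
  induction hσ : σ (shift t w) with
  | top =>
    rw [hσ, add_top] at h
    rw [discountedPayoff_of_eq_top h, discountedPayoff_of_eq_top hσ, mul_zero]
  | coe r =>
    rw [hσ, ← ENNReal.coe_add] at h
    rw [discountedPayoff_of_eq_coe h, discountedPayoff_of_eq_coe hσ, discount_add, shift_apply,
      mul_assoc]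

lemma discountedPayoff_past (hT : IsPathStoppingTime T) (h : T w < ∞) :
    discountedPayoff coord T k f (past T w) = discountedPayoff coord T k f w := by
  have ht : T w = (T w).toNNReal := (ENNReal.coe_toNNReal h.ne).symm
  rw [past, discountedPayoff_of_eq_coe ((hT.stopped_eq_iff w _).2 ht),
    discountedPayoff_of_eq_coe ht, discount_stopped, stopped_apply, min_self]

lemma discountedPayoff_indicator_eq_zero {y : S} (hw : w ∉ endsAt T y) :
    discountedPayoff coord T k (({y} : Set S).indicator fun _ => 1) w = 0 := by
  induction h : T w with
  | top => exact discountedPayoff_of_eq_top h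
  | coe t =>
    rw [discountedPayoff_of_eq_coe h, Set.indicator_of_notMem, mul_zero]
    exact fun hy => hw ⟨h ▸ ENNReal.coe_lt_top, by rwa [h, ENNReal.toNNReal_coe]⟩

lemma measurable_discountedPayoff (k f : S → ℂ) (hT : Measurable T) :
    Measurable (discountedPayoff coord T k f) := by
  classical
  exact Measurable.ite (measurableSet_lt hT measurable_const)
    ((measurable_discount k hT.ennreal_toNNReal).mul
      ((measurable_of_finite f).comp (measurable_coord_comp hT.ennreal_toNNReal measurable_id)))
    measurable_const

lemma norm_discountedPayoff_le (hk : ∀ z, 0 ≤ (k z).re) (f : S → ℂ) (w : PathSpace S) :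
    ‖discountedPayoff coord T k f w‖ ≤ ‖f‖ := by
  induction h : T w with
  | top => simp only [discountedPayoff_of_eq_top h, norm_zero, norm_nonneg]
  | coe t =>
    rw [discountedPayoff_of_eq_coe h, norm_mul]
    exact (mul_le_of_le_one_left (norm_nonneg _) (norm_discount_le_one hk t w)).trans
      (norm_le_pi_norm f _)

lemma integrable_discountedPayoff_coord (hk : ∀ z, 0 ≤ (k z).re) (f : S → ℂ) (hT : Measurable T)
    (μ : Measure (PathSpace S)) [IsFiniteMeasure μ] : Integrable (discountedPayoff coord T k f) μ :=
  Integrable.of_bound (measurable_discountedPayoff k f hT).aestronglyMeasurable ‖f‖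
    (Eventually.of_forall (norm_discountedPayoff_le hk f))

end Payoff

section LinearSystem

variable {G : Matrix S S ℝ} {Q : S → Measure (PathSpace S)}

lemma integral_discountedPayoff_mul_future {T : PathSpace S → ℝ≥0∞} (hQ : HasMarkovPropertyAt Q T)
    (hT : IsPathStoppingTime T) (k : S → ℂ) (x y : S) [SFinite (Q x)] [SFinite (Q y)]
    {Ψ : PathSpace S → ℂ} (hΨ : Measurable Ψ) :
    ∫ w, discountedPayoff coord T k (({y} : Set S).indicator fun _ => 1) w * Ψ (future T w) ∂(Q x) =
      (∫ w, discountedPayoff coord T k (({y} : Set S).indicator fun _ => 1) w ∂(Q x)) *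
        ∫ w, Ψ w ∂(Q y) := by
  set Φ := discountedPayoff coord T k (({y} : Set S).indicator fun _ => 1)
  have hzero (w : PathSpace S) (hw : w ∉ endsAt T y) : Φ w = 0 :=
    discountedPayoff_indicator_eq_zero hw
  have hpast (w : PathSpace S) (hw : w ∈ endsAt T y) : Φ w = Φ (past T w) :=
    (discountedPayoff_past hT hw.1).symm
  have hends := measurableSet_endsAt hT.measurable y
  rw [← setIntegral_eq_integral_of_forall_compl_eq_zero fun w hw => by rw [hzero w hw, zero_mul],
    ← setIntegral_eq_integral_of_forall_compl_eq_zero hzero, setIntegral_congr_fun hends hpast,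
    setIntegral_congr_fun hends fun w hw => congrArg (· * Ψ (future T w)) (hpast w hw)]
  exact hQ.setIntegral_past_mul_future hT.measurable x y
    (measurable_discountedPayoff k _ hT.measurable) hΨ

lemma discountedPayoff_drawdownTime_eq {a : ℝ} (ha : 0 < a) (k f : S → ℂ) {x : S}
    {w : PathSpace S} (h0 : w 0 = x) :
    discountedPayoff coord (drawdownTime coord a) k f w =
      discountedPayoff coord (firstPassageTime coord (Set.Ioc ((x : ℝ) - a) x)) k
          ({z : S | (z : ℝ) ≤ x - a}.indicator f) w +
        ∑ y ∈ Finset.univ.filter (fun y : S => (x : ℝ) < y),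
          discountedPayoff coord (firstPassageTime coord (Set.Ioc ((x : ℝ) - a) x)) k
              (({y} : Set S).indicator fun _ => 1) w *
            discountedPayoff coord (drawdownTime coord a) k f
              (future (firstPassageTime coord (Set.Ioc ((x : ℝ) - a) x)) w) := by
  have hle := firstPassageTime_le_drawdownTime a x w
  set T : PathSpace S → ℝ≥0∞ := firstPassageTime coord (Set.Ioc ((x : ℝ) - a) x)
  induction hT : T w with
  | top =>
    simp only [discountedPayoff_of_eq_top hT, discountedPayoff_of_eq_top (top_le_iff.1 (hT ▸ hle)),
      zero_mul, Finset.sum_const_zero, add_zero]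
  | coe t =>
    have hfuture : future T w = shift t w := by rw [future, hT, ENNReal.toNNReal_coe]
    rw [hT] at hle
    have hsum (c : ℂ) : ∑ y ∈ Finset.univ.filter (fun y : S => (x : ℝ) < y),
        ({y} : Set S).indicator (fun _ => (1 : ℂ)) (w t) * c = if (x : ℝ) < w t then c else 0 := by
      simp only [Set.indicator_apply, Set.mem_singleton_iff, Finset.sum_ite_eq,
        Finset.mem_filter, Finset.mem_univ, true_and, ite_mul, one_mul, zero_mul]
    simp only [discountedPayoff_of_eq_coe hT, hfuture, mul_assoc, ← Finset.mul_sum, ← mul_add,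
      hsum]
    simp only [Set.indicator_apply, Set.mem_ofPred_eq]
    rcases le_or_gt (w t : ℝ) (x - a) with hbelow | hgt
    · have hτ : drawdownTime coord a w = t :=
        (drawdownTime_le zero_le (by rwa [h0])).antisymm hle
      rw [if_pos hbelow, if_neg (by linarith), add_zero, discountedPayoff_of_eq_coe hτ]
    · have habove : (x : ℝ) < w t :=
        lt_of_not_ge fun hge => coord_notMem_of_firstPassageTime_eq hT ⟨hgt, hge⟩
      have hrecord (u : ℝ≥0) (hu : u ≤ t) : w u ≤ w t := by
        rcases hu.eq_or_lt with rfl | hlt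
        · exact le_rfl
        · have hmem := coord_mem_of_lt_firstPassageTime (hT ▸ ENNReal.coe_lt_coe.2 hlt)
          exact (hmem.2.trans_lt habove).le
      rw [if_neg hgt.not_ge, if_pos habove, zero_add,
        discountedPayoff_of_eq_add (drawdownTime_eq_add_shift hrecord hle)]

lemma drawdownValue_coord_eq (hQ : IsMarkovChain G Q coord) {a : ℝ} (ha : 0 < a) (f : S → ℂ)
    {k : S → ℂ} (hk : ∀ z, 0 ≤ (k z).re) (x : S) :
    drawdownValue Q coord a f k x =
      passageValue Q coord (Set.Ioc ((x : ℝ) - a) x) k x ({z : S | (z : ℝ) ≤ x - a}.indicator f) +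
        ∑ y ∈ Finset.univ.filter (fun y : S => (x : ℝ) < y),
          passageValue Q coord (Set.Ioc ((x : ℝ) - a) x) k x (({y} : Set S).indicator fun _ => 1) *
            drawdownValue Q coord a f k y := by
  have := hQ.isProbabilityMeasure
  have hT := isPathStoppingTime_firstPassageTime (S := S) (Set.Ioc ((x : ℝ) - a) x)
  have hmarkov := hT.hasMarkovPropertyAt (hasMarkovPropertyAt_const hQ)
  have hB := measurable_discountedPayoff k f (measurable_drawdownTime (S := S) a)
  have hint (g : S → ℂ) := integrable_discountedPayoff_coord hk g hT.measurable (Q x)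
  have hBfuture : Measurable fun w => discountedPayoff coord (drawdownTime coord a) k f
      (future (firstPassageTime coord (Set.Ioc ((x : ℝ) - a) x)) w) :=
    hB.comp (measurable_future hT.measurable)
  have hint_mul (y : S) := (hint (({y} : Set S).indicator fun _ => 1)).mul_bdd
    hBfuture.aestronglyMeasurable (Eventually.of_forall fun w => norm_discountedPayoff_le hk f _)
  rw [drawdownValue, integral_congr_ae ((ae_coord_zero hQ x).mono fun w hw =>
      discountedPayoff_drawdownTime_eq ha k f hw),
    integral_add (hint _) (integrable_finsetSum _ fun y _ => hint_mul y),
    integral_finsetSum _ fun y _ => hint_mul y]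
  exact congrArg (_ + ·) <| Finset.sum_congr rfl fun y _ =>
    integral_discountedPayoff_mul_future hmarkov hT k x y hB

end LinearSystem

end PathSpace

namespace IsMarkovChain

open PathSpace

variable {Ω : Type*} [MeasurableSpace Ω] {S : Finset ℝ} {G : Matrix S S ℝ} {P : S → Measure Ω}
  {Y : ℝ≥0 → Ω → S}

/-- The path of a Markov chain as an element of the path space. Its law carries every statement
about the chain over to the coordinate process. -/
def path (hY : IsMarkovChain G P Y) (ω : Ω) : PathSpace S := ⟨fun t => Y t ω, hY.rightContinuous ω⟩

lemma measurable_path (hY : IsMarkovChain G P Y) : Measurable hY.path :=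
  Measurable.subtype_mk (measurable_pi_lambda _ hY.measurable)

lemma isMarkovChain_coord (hY : IsMarkovChain G P Y) :
    IsMarkovChain G (fun x => (P x).map hY.path) coord where
  isProbabilityMeasure x :=
    have := hY.isProbabilityMeasure x
    Measure.isProbabilityMeasure_map hY.measurable_path.aemeasurable
  measurable := measurable_coord
  rightContinuous w := w.2
  finiteDimensional x n t y ht h0 := by
    have hset : MeasurableSet {w : PathSpace S | ∀ i, coord (t i) w = y i} := by
      rw [Set.ofPred_forall]
      exact MeasurableSet.iInter fun i => measurableSet_coord_eq (t i) (y i)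
    rw [map_measureReal_apply hY.measurable_path hset]
    exact hY.finiteDimensional x n t y ht h0

lemma integrable_discountedPayoff (hY : IsMarkovChain G P Y) {k : S → ℂ} (hk : ∀ z, 0 ≤ (k z).re)
    (f : S → ℂ) {T : PathSpace S → ℝ≥0∞} (hT : Measurable T) (x : S) :
    Integrable (discountedPayoff Y (fun ω => T (hY.path ω)) k f) (P x) :=
  have := hY.isMarkovChain_coord.isProbabilityMeasure x
  (integrable_discountedPayoff_coord hk f hT _).comp_measurable hY.measurable_path

lemma drawdownValue_map_path (hY : IsMarkovChain G P Y) (a : ℝ) (f k : S → ℂ) (x : S) :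
    drawdownValue (fun x => (P x).map hY.path) coord a f k x = drawdownValue P Y a f k x :=
  integral_map hY.measurable_path.aemeasurable
    (measurable_discountedPayoff k f (measurable_drawdownTime a)).aestronglyMeasurable

lemma passageValue_map_path (hY : IsMarkovChain G P Y) (A : Set ℝ) (k : S → ℂ) (x : S)
    (g : S → ℂ) :
    passageValue (fun x => (P x).map hY.path) coord A k x g = passageValue P Y A k x g :=
  integral_map hY.measurable_path.aemeasurable
    (measurable_discountedPayoff k g (measurable_firstPassageTime A)).aestronglyMeasurable

end IsMarkovChain

end CTMC

theorem mainTheorem3 {Ω : Type*} [MeasurableSpace Ω] {S : Finset ℝ}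
    (G : Matrix S S ℝ) (hG : CTMC.IsRateMatrix G)
    (P : S → Measure Ω) (Y : ℝ≥0 → Ω → S) (hY : CTMC.IsMarkovChain G P Y)
    (a : ℝ) (ha : 0 < a) (f : S → ℂ) (k : S → ℂ) (hk : ∀ x, 0 ≤ (k x).re) (x : S) :
    -- all expectations that occur below are expectations of integrable random variables
    ((∀ y : S, Integrable (CTMC.discountedPayoff Y (CTMC.drawdownTime Y a) k f) (P y)) ∧
      (∀ g : S → ℂ, Integrable
        (CTMC.discountedPayoff Y
          (CTMC.firstPassageTime Y (Set.Ioc ((x : ℝ) - a) (x : ℝ))) k g) (P x))) ∧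
    -- the linear system
    CTMC.drawdownValue P Y a f k x =
      CTMC.passageValue P Y (Set.Ioc ((x : ℝ) - a) (x : ℝ)) k x
          ({z : S | (z : ℝ) ≤ (x : ℝ) - a}.indicator f) +
        ∑ y ∈ Finset.univ.filter (fun y : S => (x : ℝ) < (y : ℝ)),
          CTMC.passageValue P Y (Set.Ioc ((x : ℝ) - a) (x : ℝ)) k x
              (({y} : Set S).indicator fun _ => 1) *
            CTMC.drawdownValue P Y a f k y := by
  refine ⟨⟨hY.integrable_discountedPayoff hk f (CTMC.PathSpace.measurable_drawdownTime a),
    fun g => hY.integrable_discountedPayoff hk g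
      (CTMC.PathSpace.measurable_firstPassageTime _) x⟩, ?_⟩
  simpa only [hY.drawdownValue_map_path, hY.passageValue_map_path] using
    CTMC.PathSpace.drawdownValue_coord_eq hY.isMarkovChain_coord ha f hk x
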